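/- Let $q<n$, $A\in\mathbb R^{n\times n}$, $B\in\mathbb R^{n\times m}$, $C\in\mathbb R^{q\times n}$, $N\in\mathbb R^{p\times q}$, $H=NC$, $\mu_0\in\mathbb R^n$, let $\Sigma_0,Q_w\in\mathbb R^{n\times n}$ be symmetric positive semidefinite, and let $\mathscr U\subseteq\mathbb R^m$ be the set of inputs. Consider the system $$\mathbf M:\quad x(t+1)=Ax(t)+Bu(t)+w(t),\qquad z(t)=Hx(t),$$ where $x(0)\sim\mathcal N(\mu_0,\Sigma_0)$ and $w(t)\sim\mathcal N(0,Q_w)$, $t\ge 0$, are independent. Define $\hat P(0)=\Sigma_0$ and, for $t\ge0$, $$K(t)=\hat P(t)C^T[C\hat P(t)C^T]^{-1},\quad \bar P(t)=\hat P(t)-K(t)C\hat P(t),\quad \hat P(t+1)=A\bar P(t)A^T+Q_w,\quad \Sigma_v(t)=C\hat P(t)C^T,$$ and the abstract system $$\bar{\mathbf M}:\quad \bar x(t+1)=A\bar x(t)+B\bar u(t)+K(t+1)v(t+1),\qquad \bar z(t)=H\bar x(t),$$ where $\bar x(0)\sim\mathcal N(\mu_0,\Sigma_0-\bar P(0))$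 and $v(t)\sim\mathcal N(0,\Sigma_v(t))$, $t\ge1$, are independent. A controller is a sequence of Borel measurable maps $\mathbf C_t:(\mathbb R^n\times\mathscr U)^t\times\mathbb R^n\to\mathscr U$, $t\ge 0$. In closed loop with a system it chooses the input at time $t$ by applying $\mathbf C_t$ to the history $x(0)u(0)x(1)\cdots u(t-1)x(t)$. Let $\mathbb P_{\mathbf C\times\mathbf M}$ and $\mathbb P_{\bar{\mathbf C}\times\bar{\mathbf M}}$ be the laws on $(\mathbb R^p)^{\mathbb N}$ of the output trajectories $(z(t))_{t\ge0}$ and $(\bar z(t))_{t\ge0}$ of the closed loops. Assume that $C\Sigma_0C^T\succ0$ and $CQ_wC^T\succ0$. Then for every controller $\bar{\mathbf C}$ of $\bar{\mathbf M}$ there is a controller $\mathbf C$ of $\mathbf M$ such that $$\mathbb P_{\bar{\mathbf C}\times\bar{\mathbf M}}(\mathcal Z_\phi)=\mathbb P_{\mathbf C\times\mathbf M}(\mathcal Z_\phi)\qquad\text{for every Borel set }\mathcal Z_\phi\subseteq(\mathbb R^p)^{\mathbb N}.$$ Moreover, $\mathbf C$ can be taken to be the following refinement of $\bar{\mathbf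 C}$: for every history $x(0)u(0)\cdots u(t-1)x(t)$, $$\mathbf C_t\big(x(0)u(0)\cdots u(t-1)x(t)\big)=\bar{\mathbf C}_t\big(\bar x(0)u(0)\cdots u(t-1)\bar x(t)\big),$$ where $\bar x(0)=\mu_0+K(0)(Cx(0)-C\mu_0)$ and, for $0\le s<t$, $\bar x(s+1)=A\bar x(s)+Bu(s)+K(s+1)v(s+1)$ with $v(s+1)=Cx(s+1)-CA\bar x(s)-CBu(s)$. -/

import Mathlib

open MeasureTheory ProbabilityTheory
open scoped Matrix

namespace KnowledgeFiltering

/-- Euclidean `k`-space. -/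
abbrev E (k : ℕ) : Type := EuclideanSpace ℝ (Fin k)

/-- Matrix-vector product on Euclidean spaces. -/
noncomputable abbrev app {k l : ℕ} (L : Matrix (Fin k) (Fin l) ℝ) (x : E l) : E k :=
  Matrix.toEuclideanLin L x

/-- Histories of length `t` with states in `ℝⁿ` and inputs in `U ⊆ ℝᵐ`: alternating sequences
`x(0) u(0) x(1) u(1) … u(t-1) x(t)`. -/
def History (n : ℕ) {m : ℕ} (U : Set (E m)) : ℕ → Type
  | 0 => E n
  | t + 1 => History n U t × U × E n

/-- The product Borel σ-algebra on histories. -/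
instance History.measurableSpace (n : ℕ) {m : ℕ} (U : Set (E m)) :
    ∀ t, MeasurableSpace (History n U t)
  | 0 => inferInstanceAs (MeasurableSpace (E n))
  | t + 1 =>
    haveI := History.measurableSpace n U t
    inferInstanceAs (MeasurableSpace (History n U t × U × E n))

/-- The last state `x(t)` of a history of length `t`. -/
def History.last {n m : ℕ} {U : Set (E m)} : ∀ {t : ℕ}, History n U t → E n
  | 0, x => x
  | _ + 1, h => h.2.2

/-- A controller: a sequence of Borel measurable policies `C_t` from histories of length `t` to
the input set `U`. -/
structure Controller (n : ℕ) {m : ℕ} (U : Set (E m)) where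
  policy : ∀ t, History n U t → U
  measurable_policy : ∀ t, Measurable (policy t)

/-- A linear stochastic system with `r`-dimensional Gaussian noise,
`x(t+1) = A x(t) + B u(t) + G(t) e(t)`, `z(t) = H x(t)`, where
`x(0) ~ N(initMean, initCov)` and `e(t) ~ N(0, noiseCov t)` are independent. -/
structure GaussianSystem (n m p r : ℕ) where
  A : Matrix (Fin n) (Fin n) ℝ
  B : Matrix (Fin n) (Fin m) ℝ
  H : Matrix (Fin p) (Fin n) ℝ
  G : ℕ → Matrix (Fin n) (Fin r) ℝ
  initMean : E n
  initCov : Matrix (Fin n) (Fin n) ℝ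
  noiseCov : ℕ → Matrix (Fin r) (Fin r) ℝ

namespace GaussianSystem

variable {n m p r : ℕ} (S : GaussianSystem n m p r) {U : Set (E m)} (c : Controller n U)

/-- The joint law of the initial state and the noise sequence: all are independent. -/
noncomputable def sourceLaw : Measure (E n × (ℕ → E r)) :=
  (multivariateGaussian S.initMean S.initCov).prod
    (Measure.infinitePi fun t => multivariateGaussian 0 (S.noiseCov t))

/-- The execution up to time `t` of the closed loop of `S` with the controller `c`, as a function
of the initial state and the noise sequence; the input is `u(t) = C_t (history at time t)`. -/
noncomputable def execution (ω : E n × (ℕ → E r)) : ∀ t, History n U t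
  | 0 => ω.1
  | t + 1 =>
    let h := execution ω t
    let u := c.policy t h
    (h, u, app S.A h.last + app S.B u + app (S.G t) (ω.2 t))

/-- The output trajectory `z(t) = H x(t)` of the closed loop. -/
noncomputable def output (ω : E n × (ℕ → E r)) : ℕ → E p :=
  fun t => app S.H (S.execution c ω t).last

/-- The distribution of the output trajectory of the closed loop. -/
noncomputable def outputLaw : Measure (ℕ → E p) :=
  S.sourceLaw.map (S.output c)

end GaussianSystem

section Kalman

variable {n q : ℕ} (A : Matrix (Fin n) (Fin n) ℝ) (C : Matrix (Fin q) (Fin n) ℝ)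
  (S₀ Q : Matrix (Fin n) (Fin n) ℝ)

/-- The Kalman gain `P Cᵀ (C P Cᵀ)⁻¹` for an a priori state variance `P`. -/
noncomputable def gainOf (P : Matrix (Fin n) (Fin n) ℝ) : Matrix (Fin n) (Fin q) ℝ :=
  P * Cᵀ * (C * P * Cᵀ)⁻¹

/-- The a priori state variances: `P̂(0) = S₀` and
`P̂(t+1) = A (P̂(t) - K(t) C P̂(t)) Aᵀ + Q`. -/
noncomputable def priorVar : ℕ → Matrix (Fin n) (Fin n) ℝ
  | 0 => S₀
  | t + 1 => A * (priorVar t - gainOf C (priorVar t) * C * priorVar t) * Aᵀ + Q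

/-- The Kalman gain `K(t)`. -/
noncomputable def gain (t : ℕ) : Matrix (Fin n) (Fin q) ℝ :=
  gainOf C (priorVar A C S₀ Q t)

/-- The a posteriori state variances `P̄(t) = P̂(t) - K(t) C P̂(t)`. -/
noncomputable def postVar (t : ℕ) : Matrix (Fin n) (Fin n) ℝ :=
  priorVar A C S₀ Q t - gain A C S₀ Q t * C * priorVar A C S₀ Q t

/-- The innovation variances `Σ_v(t) = C P̂(t) Cᵀ`. -/
noncomputable def innovationVar (t : ℕ) : Matrix (Fin q) (Fin q) ℝ :=
  C * priorVar A C S₀ Q t * Cᵀ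

end Kalman

section Models

variable {n m p q : ℕ} (A : Matrix (Fin n) (Fin n) ℝ) (B : Matrix (Fin n) (Fin m) ℝ)
  (H : Matrix (Fin p) (Fin n) ℝ) (C : Matrix (Fin q) (Fin n) ℝ)
  (μ₀ : E n) (S₀ Q : Matrix (Fin n) (Fin n) ℝ)

/-- The original system: `x(t+1) = A x(t) + B u(t) + w(t)`, `z(t) = H x(t)`,
`x(0) ~ N(μ₀, S₀)`, `w(t) ~ N(0, Q)`. -/
def originalSystem : GaussianSystem n m p n where
  A := A
  B := B
  H := H
  G := fun _ => 1
  initMean := μ₀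
  initCov := S₀
  noiseCov := fun _ => Q

/-- The abstract system (a posteriori innovation process):
`x̄(t+1) = A x̄(t) + B ū(t) + K(t+1) v(t+1)`, `z̄(t) = H x̄(t)`,
`x̄(0) ~ N(μ₀, S₀ - P̄(0))`, `v(t) ~ N(0, Σ_v(t))`. The noise `e(t)` of the step from `t` to
`t + 1` is `v(t+1)`. -/
noncomputable def abstractSystem : GaussianSystem n m p q where
  A := A
  B := B
  H := H
  G := fun t => gain A C S₀ Q (t + 1)
  initMean := μ₀
  initCov := S₀ - postVar A C S₀ Q 0
  noiseCov := fun t => innovationVar A C S₀ Q (t + 1)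

/-- The Kalman filter of the refinement algorithm: it turns a history `x(0) u(0) … x(t)` of the
original system into the abstract history `x̄(0) u(0) … x̄(t)`, where
`x̄(0) = μ₀ + K(0) (C x(0) - C μ₀)`, `v(t+1) = C x(t+1) - C A x̄(t) - C B u(t)` and
`x̄(t+1) = A x̄(t) + B u(t) + K(t+1) v(t+1)`. -/
noncomputable def filterHistory {U : Set (E m)} : ∀ t, History n U t → History n U t
  | 0, x => (μ₀ + app (gain A C S₀ Q 0) (app C x - app C μ₀) : E n)
  | t + 1, (h, u, x) =>
    let h' := filterHistory t h
    let v := app C x - app (C * A) h'.last - app (C * B) u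
    (h', u, app A h'.last + app B u + app (gain A C S₀ Q (t + 1)) v)

/-- The controller `c` is the refinement of the abstract controller `c'`: at each time it applies
the input which `c'` chooses on the filtered history. -/
def IsRefinement {U : Set (E m)} (c' c : Controller n U) : Prop :=
  ∀ t (h : History n U t), c.policy t h = c'.policy t (filterHistory A B C μ₀ S₀ Q t h)

end Models

end KnowledgeFiltering

open KnowledgeFiltering

/-! Run the original loop with the refined controller and let `e(t) = x(t) - x̄(t)` be the filter
error. Both loops receive the same input, so `B u(t)` cancels: with `d = A e(t) + w(t)`, one has
`v(t+1) = C d` and `e(t+1) = (1 - K(t+1) C) d`, whatever the controller is. Hence the filtered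
history is, path by path, the abstract execution driven by `x̄(0)` and the innovations `v`
(`filterHistory_execution`). Since the measurement `C x` is noise-free and `C P̂ Cᵀ` is invertible,
`C K = 1`. Thus `C e(t) = 0`, hence `H e(t) = N C e(t) = 0`, and the outputs agree on every path
(`output_refine`).

It remains to show that `(x̄(0), v)` has the law of the abstract sources (`map_innovations`). By the
choice of the gain, `C d` and `(1 - K C) d` are uncorrelated, hence independent, being jointly
Gaussian. So each step carries the product law of `(e(t), w(t))` to the product law of `(v(t+1),
e(t+1))` (`map_errorStep`), and a general statement on such recursions makes the innovations
independent (`map_chainOutput_eq_infinitePi`). -/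

namespace KnowledgeFiltering

/-! ### Linear images of Gaussian vectors, by characteristic functions. -/

lemma measurable_app {k l : ℕ} (L : Matrix (Fin k) (Fin l) ℝ) : Measurable (app L) :=
  (LinearMap.continuous_of_finiteDimensional _).measurable

lemma app_mul {j k l : ℕ} (L : Matrix (Fin j) (Fin k) ℝ) (M : Matrix (Fin k) (Fin l) ℝ)
    (x : E l) : app (L * M) x = app L (app M x) := by
  ext i
  simp [Matrix.toLpLin_apply, Matrix.mulVec_mulVec]

lemma app_add {k l : ℕ} (L : Matrix (Fin k) (Fin l) ℝ) (x y : E l) :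
    app L (x + y) = app L x + app L y :=
  map_add _ x y

lemma app_sub {k l : ℕ} (L : Matrix (Fin k) (Fin l) ℝ) (x y : E l) :
    app L (x - y) = app L x - app L y :=
  map_sub _ x y

lemma app_zero {k l : ℕ} (L : Matrix (Fin k) (Fin l) ℝ) : app L 0 = 0 :=
  map_zero _

lemma app_one {k : ℕ} (x : E k) : app (1 : Matrix (Fin k) (Fin k) ℝ) x = x := by
  ext i
  simp [Matrix.toLpLin_apply]

lemma app_sub_matrix {k l : ℕ} (L M : Matrix (Fin k) (Fin l) ℝ) (x : E l) :
    app (L - M) x = app L x - app M x := by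
  simp [app]

lemma inner_app {k l : ℕ} (L : Matrix (Fin k) (Fin l) ℝ) (x : E l) (y : E k) :
    inner ℝ (app L x) y = inner ℝ x (app Lᵀ y) := by
  simp only [EuclideanSpace.inner_eq_star_dotProduct, Matrix.toLpLin_apply, star_trivial]
  rw [Matrix.dotProduct_mulVec, Matrix.mulVec_transpose, dotProduct_comm]

lemma charFun_map_app {k l : ℕ} (ν : Measure (E l)) (L : Matrix (Fin k) (Fin l) ℝ) (t : E k) :
    charFun (ν.map (app L)) t = charFun ν (app Lᵀ t) := by
  rw [charFun_apply, charFun_apply, integral_map (measurable_app L).aemeasurable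
    (by fun_prop)]
  simp_rw [inner_app]

/-- The quadratic form of a congruence `L S Lᵀ`. -/
lemma dotProduct_mulVec_congr {k l : ℕ} (L : Matrix (Fin k) (Fin l) ℝ)
    (S : Matrix (Fin l) (Fin l) ℝ) (t : Fin k → ℝ) :
    t ⬝ᵥ (L * S * Lᵀ) *ᵥ t = (Lᵀ *ᵥ t) ⬝ᵥ S *ᵥ (Lᵀ *ᵥ t) := by
  rw [← Matrix.mulVec_mulVec, ← Matrix.mulVec_mulVec, Matrix.dotProduct_mulVec,
    ← Matrix.mulVec_transpose]

lemma posSemidef_congr {k l : ℕ} (L : Matrix (Fin k) (Fin l) ℝ)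
    {S : Matrix (Fin l) (Fin l) ℝ} (hS : S.PosSemidef) : (L * S * Lᵀ).PosSemidef := by
  simpa using hS.mul_mul_conjTranspose_same L

/-- Prediction: the law of `A e + w` for independent centred Gaussian `e` and `w`. -/
lemma map_app_add_multivariateGaussian {k l : ℕ} (L : Matrix (Fin k) (Fin l) ℝ)
    {S : Matrix (Fin l) (Fin l) ℝ} {Q : Matrix (Fin k) (Fin k) ℝ}
    (hS : S.PosSemidef) (hQ : Q.PosSemidef) :
    ((multivariateGaussian 0 S).prod (multivariateGaussian 0 Q)).map
      (fun x => app L x.1 + x.2) = multivariateGaussian 0 (L * S * Lᵀ + Q) := by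
  have hL := measurable_app L
  have hsplit : (fun x : E l × E k => app L x.1 + x.2)
      = (fun y : E k × E k => y.1 + y.2) ∘ Prod.map (app L) id := rfl
  rw [hsplit, ← Measure.map_map (by fun_prop) (hL.prodMap measurable_id),
    ← Measure.map_prod_map _ _ hL measurable_id, Measure.map_id]
  have := Measure.isProbabilityMeasure_map (μ := multivariateGaussian 0 S) hL.aemeasurable
  refine Measure.ext_of_charFun (funext fun t => ?_)
  rw [charFun_map_add_prod_eq_mul]
  rw [Pi.mul_apply, charFun_map_app, charFun_multivariateGaussian hS,
    charFun_multivariateGaussian hQ,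
    charFun_multivariateGaussian ((posSemidef_congr L hS).add hQ), ← Complex.exp_add,
    Matrix.add_mulVec, dotProduct_add, dotProduct_mulVec_congr]
  congr 1
  simp only [inner_zero_right, Matrix.ofLp_toLpLin, Matrix.toLin'_apply]
  push_cast
  ring

/-- Uncorrelated linear images of a centred Gaussian vector are independent. -/
lemma map_prodMk_multivariateGaussian {j k l : ℕ} (L : Matrix (Fin j) (Fin l) ℝ)
    (M : Matrix (Fin k) (Fin l) ℝ) {S : Matrix (Fin l) (Fin l) ℝ} (hS : S.PosSemidef)
    (hLM : L * S * Mᵀ = 0) :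
    (multivariateGaussian 0 S).map (fun x => (app L x, app M x)) =
      (multivariateGaussian 0 (L * S * Lᵀ)).prod (multivariateGaussian 0 (M * S * Mᵀ)) := by
  have hm : Measurable fun x : E l => (app L x, app M x) :=
    (measurable_app L).prodMk (measurable_app M)
  have := Measure.isProbabilityMeasure_map (μ := multivariateGaussian 0 S) hm.aemeasurable
  refine charFun_eq_prod_iff.1 fun t => ?_
  have hML : M * S * Lᵀ = 0 := by
    have h := congrArg Matrix.transpose hLM
    simpa [Matrix.mul_assoc, show Sᵀ = S by simpa using hS.isHermitian.eq] using h
  -- The joint characteristic function is that of the source at `Lᵀ t₁ + Mᵀ t₂`; it factors once the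
  -- mixed terms of the quadratic form vanish.
  have hchar : charFun (((multivariateGaussian 0 S).map
      (fun x => (app L x, app M x))).map (WithLp.toLp 2)) t =
      charFun (multivariateGaussian 0 S) (app Lᵀ t.fst + app Mᵀ t.snd) := by
    rw [Measure.map_map (by fun_prop) hm, charFun_apply, charFun_apply,
      integral_map (by fun_prop) (by fun_prop)]
    simp [WithLp.prod_inner_apply, inner_app, inner_add_right]
  have hcross : ∀ (a : Fin j → ℝ) (b : Fin k → ℝ), (Lᵀ *ᵥ a) ⬝ᵥ S *ᵥ (Mᵀ *ᵥ b) = 0 := by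
    intro a b
    rw [Matrix.mulVec_transpose, ← Matrix.dotProduct_mulVec, Matrix.mulVec_mulVec,
      Matrix.mulVec_mulVec, hLM]
    simp
  have hcross' : ∀ (a : Fin j → ℝ) (b : Fin k → ℝ), (Mᵀ *ᵥ b) ⬝ᵥ S *ᵥ (Lᵀ *ᵥ a) = 0 := by
    intro a b
    rw [Matrix.mulVec_transpose, ← Matrix.dotProduct_mulVec, Matrix.mulVec_mulVec,
      Matrix.mulVec_mulVec, hML]
    simp
  rw [hchar, charFun_multivariateGaussian hS,
    charFun_multivariateGaussian (posSemidef_congr L hS),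
    charFun_multivariateGaussian (posSemidef_congr M hS), ← Complex.exp_add,
    dotProduct_mulVec_congr, dotProduct_mulVec_congr]
  congr 1
  simp only [inner_zero_right, Matrix.ofLp_toLpLin, Matrix.toLin'_apply, WithLp.ofLp_add,
    Matrix.mulVec_add, dotProduct_add, add_dotProduct, hcross, hcross',
    WithLp.ofLp_fst, WithLp.ofLp_snd]
  push_cast
  ring

/-- No semidefiniteness is needed: both sides unfold to images of one reference measure under maps
that differ by a translation. -/
lemma map_const_add_multivariateGaussian {k : ℕ} (a μ : E k) (S : Matrix (Fin k) (Fin k) ℝ) :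
    (multivariateGaussian μ S).map (fun x => a + x) = multivariateGaussian (a + μ) S := by
  rw [multivariateGaussian, multivariateGaussian, Measure.map_map (by fun_prop) (by fun_prop)]
  congr 1
  ext1 x
  simp [add_assoc]

/-! ### Product measures on sequences. -/

/-- Prepend a term to a sequence. -/
def seqCons {α : Type*} (a : α) (s : ℕ → α) : ℕ → α
  | 0 => a
  | t + 1 => s t

lemma measurable_seqCons {α : Type*} [MeasurableSpace α] :
    Measurable fun x : α × (ℕ → α) => seqCons x.1 x.2 := by
  refine measurable_pi_lambda _ fun t => ?_
  cases t with
  | zero => exact measurable_fst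
  | succ t => exact (measurable_pi_apply t).comp measurable_snd

/-- The preimage of a box is a rectangle; this peels off one coordinate in inductions on the length
of the box. -/
lemma map_seqCons_pi_range {α : Type*} [MeasurableSpace α] (ν : Measure α)
    (ρ : Measure (ℕ → α)) [SFinite ν] [SFinite ρ] (T : ℕ) {s : ℕ → Set α}
    (hs : ∀ i, MeasurableSet (s i)) :
    (ν.prod ρ).map (fun x => seqCons x.1 x.2) (Set.pi (Finset.range (T + 1)) s) =
      ν (s 0) * ρ (Set.pi (Finset.range T) fun i => s (i + 1)) := by
  rw [Measure.map_apply measurable_seqCons (.pi (Finset.countable_toSet _) fun i _ => hs i),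
    ← Measure.prod_prod]
  congr 1
  ext ⟨a, x⟩
  simp only [Set.mem_preimage, Set.mem_pi, Finset.coe_range, Set.mem_Iio, Set.mem_prod]
  constructor
  · exact fun h => ⟨h 0 T.succ_pos, fun i hi => h (i + 1) (Nat.succ_lt_succ hi)⟩
  · rintro ⟨h₀, h⟩ (_ | i) hi
    · exact h₀
    · exact h i (Nat.lt_of_succ_lt_succ hi)

/-- A measure on sequences is a product measure if it is one on the boxes over initial segments. -/
lemma eq_infinitePi_of_pi_range {α : Type*} [MeasurableSpace α] {ν : ℕ → Measure α}
    [∀ t, IsProbabilityMeasure (ν t)] {ρ : Measure (ℕ → α)}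
    (h : ∀ (T : ℕ) (s : ℕ → Set α), (∀ i, MeasurableSet (s i)) →
      ρ (Set.pi (Finset.range T) s) = ∏ i ∈ Finset.range T, ν i (s i)) :
    ρ = Measure.infinitePi ν := by
  classical
  refine Measure.eq_infinitePi ν fun I s hs => ?_
  obtain ⟨T, hT⟩ := I.exists_nat_subset_range
  -- Coordinates outside `I` are filled with the whole space, which contributes factors `1`.
  have hbox := h T (fun i => if i ∈ I then s i else Set.univ) fun i => by
    split_ifs
    exacts [hs i, .univ]
  have hset : Set.pi (Finset.range T : Set ℕ) (fun i => if i ∈ I then s i else Set.univ) =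
      Set.pi (I : Set ℕ) s := by
    ext x
    simp only [Set.mem_pi, Finset.mem_coe]
    constructor
    · intro hx i hi
      simpa [hi] using hx i (hT hi)
    · intro hx i _
      split_ifs with hi
      exacts [hx i hi, trivial]
  rw [← hset, hbox, ← Finset.prod_subset hT]
  · exact Finset.prod_congr rfl fun i hi => by simp [hi]
  · intro i _ hi
    simp [hi]

lemma map_seqCons_infinitePi {α : Type*} [MeasurableSpace α] (ν : ℕ → Measure α)
    [∀ t, IsProbabilityMeasure (ν t)] :
    ((ν 0).prod (Measure.infinitePi fun t => ν (t + 1))).map (fun x => seqCons x.1 x.2) =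
      Measure.infinitePi ν := by
  refine eq_infinitePi_of_pi_range fun T s hs => ?_
  cases T with
  | zero =>
    have := Measure.isProbabilityMeasure_map
      (μ := (ν 0).prod (Measure.infinitePi fun t => ν (t + 1)))
      (measurable_seqCons (α := α)).aemeasurable
    simp
  | succ T =>
    rw [map_seqCons_pi_range _ _ _ hs, Measure.infinitePi_pi _ fun i _ => hs (i + 1),
      Finset.prod_range_succ', mul_comm]

/-! ### Recursions that emit independent outputs. -/

section Chain

variable {X W V : Type*}

/-- The states of the recursion `(v(t), e(t+1)) = f t (e(t), w(t))`. -/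
def chainState (f : ℕ → X × W → V × X) (ω : X × (ℕ → W)) : ℕ → X
  | 0 => ω.1
  | t + 1 => (f t (chainState f ω t, ω.2 t)).2

/-- The outputs of the recursion `(v(t), e(t+1)) = f t (e(t), w(t))`. -/
def chainOutput (f : ℕ → X × W → V × X) (ω : X × (ℕ → W)) (t : ℕ) : V :=
  (f t (chainState f ω t, ω.2 t)).1

/-- After one step the recursion restarts from its new state with all data shifted in time. -/
lemma chainState_seqCons (f : ℕ → X × W → V × X) (x : X) (a : W) (w : ℕ → W) (t : ℕ) :
    chainState f (x, seqCons a w) (t + 1) =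
      chainState (fun s => f (s + 1)) ((f 0 (x, a)).2, w) t := by
  induction t with
  | zero => rfl
  | succ t ih => rw [chainState, ih, chainState]; rfl

lemma chainOutput_seqCons (f : ℕ → X × W → V × X) (x : X) (a : W) (w : ℕ → W) :
    chainOutput f (x, seqCons a w) =
      seqCons (f 0 (x, a)).1 (chainOutput (fun s => f (s + 1)) ((f 0 (x, a)).2, w)) := by
  funext t
  cases t with
  | zero => rfl
  | succ t => rw [chainOutput, chainState_seqCons]; rfl

variable [MeasurableSpace X] [MeasurableSpace W] [MeasurableSpace V]

lemma measurable_chainState {f : ℕ → X × W → V × X} (hf : ∀ t, Measurable (f t)) (t : ℕ) :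
    Measurable fun ω => chainState f ω t := by
  induction t with
  | zero => exact measurable_fst
  | succ t ih =>
    exact ((hf t).comp (ih.prodMk ((measurable_pi_apply t).comp measurable_snd))).snd

lemma measurable_chainOutput {f : ℕ → X × W → V × X} (hf : ∀ t, Measurable (f t)) :
    Measurable (chainOutput f) :=
  measurable_pi_lambda _ fun t => ((hf t).comp
    ((measurable_chainState hf t).prodMk ((measurable_pi_apply t).comp measurable_snd))).fst

/-- One step of the recursion splits off the first output as an independent variable. -/
lemma map_chainOutput_eq_map_seqCons {f : ℕ → X × W → V × X} (hf : ∀ t, Measurable (f t))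
    (ε : ℕ → Measure X) (η : ℕ → Measure W) (ν : ℕ → Measure V)
    [∀ t, IsProbabilityMeasure (ε t)] [∀ t, IsProbabilityMeasure (η t)]
    [∀ t, IsProbabilityMeasure (ν t)]
    (h : ((ε 0).prod (η 0)).map (f 0) = (ν 0).prod (ε 1)) :
    ((ε 0).prod (Measure.infinitePi η)).map (chainOutput f) =
      ((ν 0).prod (((ε 1).prod (Measure.infinitePi fun t => η (t + 1))).map
        (chainOutput fun t => f (t + 1)))).map (fun x => seqCons x.1 x.2) := by
  set ρ := Measure.infinitePi fun t => η (t + 1)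
  have hf' : ∀ t, Measurable ((fun t => f (t + 1)) t) := fun t => hf (t + 1)
  have hcons := measurable_seqCons (α := W)
  have hconsV := measurable_seqCons (α := V)
  have hout := measurable_chainOutput hf
  have hout' := measurable_chainOutput hf'
  -- Regrouping isolates `(e(0), w(0))`, on which `f 0` acts, from the independent later noise.
  have e₁ : (ε 0).prod (Measure.infinitePi η) =
      (((ε 0).prod (η 0)).prod ρ).map (fun x => (x.1.1, seqCons x.1.2 x.2)) := by
    rw [← map_seqCons_infinitePi η, ← Measure.map_id (μ := ε 0),
      Measure.map_prod_map _ _ measurable_id hcons, Measure.map_id, ← Measure.prodAssoc_prod,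
      Measure.map_map (measurable_id.prodMap hcons) (by fun_prop)]
    rfl
  have e₂ : (ν 0).prod (((ε 1).prod ρ).map (chainOutput fun t => f (t + 1))) =
      (((ν 0).prod (ε 1)).prod ρ).map
        (fun x => (x.1.1, chainOutput (fun t => f (t + 1)) (x.1.2, x.2))) := by
    conv_lhs => rw [← Measure.map_id (μ := ν 0)]
    rw [Measure.map_prod_map _ _ measurable_id hout', ← Measure.prodAssoc_prod,
      Measure.map_map (measurable_id.prodMap hout') (by fun_prop)]
    rfl
  have e₃ : ((ν 0).prod (ε 1)).prod ρ =
      (((ε 0).prod (η 0)).prod ρ).map (Prod.map (f 0) id) := by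
    rw [← Measure.map_prod_map _ _ (hf 0) measurable_id, Measure.map_id, h]
  have m₁ : Measurable fun x : (X × W) × (ℕ → W) => (x.1.1, seqCons x.1.2 x.2) :=
    measurable_fst.fst.prodMk (hcons.comp (measurable_fst.snd.prodMk measurable_snd))
  have m₂ : Measurable fun x : (V × X) × (ℕ → W) =>
      (x.1.1, chainOutput (fun t => f (t + 1)) (x.1.2, x.2)) :=
    measurable_fst.fst.prodMk (hout'.comp (measurable_fst.snd.prodMk measurable_snd))
  rw [e₁, e₂, e₃, Measure.map_map hout m₁,
    Measure.map_map m₂ ((hf 0).prodMap measurable_id),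
    Measure.map_map hconsV (m₂.comp ((hf 0).prodMap measurable_id))]
  congr 1
  funext x
  exact chainOutput_seqCons f x.1.1 x.1.2 x.2

/-- If each step of the recursion `(v(t), e(t+1)) = f t (e(t), w(t))` turns the product law
`ε t ⊗ η t` into the product law `ν t ⊗ ε (t + 1)`, then the outputs are independent with
laws `ν t`. -/
theorem map_chainOutput_eq_infinitePi {f : ℕ → X × W → V × X} (hf : ∀ t, Measurable (f t))
    (ε : ℕ → Measure X) (η : ℕ → Measure W) (ν : ℕ → Measure V)
    [∀ t, IsProbabilityMeasure (ε t)] [∀ t, IsProbabilityMeasure (η t)]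
    [∀ t, IsProbabilityMeasure (ν t)]
    (h : ∀ t, ((ε t).prod (η t)).map (f t) = (ν t).prod (ε (t + 1))) :
    ((ε 0).prod (Measure.infinitePi η)).map (chainOutput f) = Measure.infinitePi ν := by
  refine eq_infinitePi_of_pi_range fun T => ?_
  -- The induction hypothesis is applied to the recursion started one step later, so all the data
  -- must vary.
  induction T generalizing f ε η ν with
  | zero =>
    intro s _
    have := Measure.isProbabilityMeasure_map (μ := (ε 0).prod (Measure.infinitePi η))
      (measurable_chainOutput hf).aemeasurable
    simp
  | succ T ih =>
    intro s hs
    have := Measure.isProbabilityMeasure_map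
      (μ := (ε 1).prod (Measure.infinitePi fun t => η (t + 1)))
      (measurable_chainOutput fun t => hf (t + 1)).aemeasurable
    rw [map_chainOutput_eq_map_seqCons hf ε η ν (h 0), map_seqCons_pi_range _ _ _ hs,
      ih (fun t => hf (t + 1)) (fun t => ε (t + 1)) (fun t => η (t + 1)) (fun t => ν (t + 1))
        (fun t => h (t + 1)) _ fun i => hs (i + 1),
      Finset.prod_range_succ', mul_comm]

end Chain

/-! ### Algebra of the Kalman gain and the measurement update. -/

section Gain

variable {n q : ℕ} {C : Matrix (Fin q) (Fin n) ℝ} {P : Matrix (Fin n) (Fin n) ℝ}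

lemma isUnit_det_of_posDef {k : ℕ} {M : Matrix (Fin k) (Fin k) ℝ} (hM : M.PosDef) :
    IsUnit M.det :=
  hM.det_pos.ne'.isUnit

/-- Noise-free measurement: the updated estimate reproduces `C x` exactly. -/
lemma mul_gainOf (hC : (C * P * Cᵀ).PosDef) : C * gainOf C P = 1 := by
  rw [gainOf, ← Matrix.mul_assoc, ← Matrix.mul_assoc,
    Matrix.mul_nonsing_inv _ (isUnit_det_of_posDef hC)]

lemma mul_one_sub_gainOf_mul (hC : (C * P * Cᵀ).PosDef) : C * (1 - gainOf C P * C) = 0 := by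
  rw [Matrix.mul_sub, ← Matrix.mul_assoc, mul_gainOf hC, Matrix.one_mul, Matrix.mul_one, sub_self]

lemma transpose_eq_of_posSemidef (hP : P.PosSemidef) : Pᵀ = P := by
  simpa using hP.isHermitian.eq

/-- The product is `P Cᵀ (C P Cᵀ)⁻¹ C P`, visibly symmetric when `P` is. -/
lemma gainOf_mul_mul_transpose (hP : P.PosSemidef) :
    (gainOf C P * C * P)ᵀ = gainOf C P * C * P := by
  simp [gainOf, Matrix.transpose_mul, Matrix.transpose_nonsing_inv,
    transpose_eq_of_posSemidef hP, Matrix.mul_assoc]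

lemma one_sub_gainOf_mul_mul_transpose (hP : P.PosSemidef) :
    P * (1 - gainOf C P * C)ᵀ = (1 - gainOf C P * C) * P := by
  have h := gainOf_mul_mul_transpose (C := C) hP
  rw [Matrix.transpose_mul, transpose_eq_of_posSemidef hP] at h
  rw [Matrix.transpose_sub, Matrix.transpose_one, Matrix.mul_sub, Matrix.sub_mul, h,
    Matrix.mul_one, Matrix.one_mul]

/-- The innovation is uncorrelated with the a posteriori error. -/
lemma mul_mul_one_sub_gainOf_transpose (hP : P.PosSemidef) (hC : (C * P * Cᵀ).PosDef) :
    C * P * (1 - gainOf C P * C)ᵀ = 0 := by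
  rw [Matrix.mul_assoc, one_sub_gainOf_mul_mul_transpose hP, ← Matrix.mul_assoc,
    mul_one_sub_gainOf_mul hC, Matrix.zero_mul]

lemma gainOf_mul_mul_one_sub_transpose (hP : P.PosSemidef) (hC : (C * P * Cᵀ).PosDef) :
    (gainOf C P * C) * P * (1 - gainOf C P * C)ᵀ = 0 := by
  rw [Matrix.mul_assoc (gainOf C P), Matrix.mul_assoc (gainOf C P),
    mul_mul_one_sub_gainOf_transpose hP hC, Matrix.mul_zero]

/-- The a posteriori variance. -/
lemma one_sub_gainOf_congr (hP : P.PosSemidef) (hC : (C * P * Cᵀ).PosDef) :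
    (1 - gainOf C P * C) * P * (1 - gainOf C P * C)ᵀ = P - gainOf C P * C * P := by
  have h := gainOf_mul_mul_one_sub_transpose hP hC
  rw [Matrix.sub_mul, Matrix.sub_mul, h, sub_zero, Matrix.one_mul,
    one_sub_gainOf_mul_mul_transpose hP, Matrix.sub_mul, Matrix.one_mul]

/-- The variance of the filtered state. -/
lemma gainOf_mul_congr (hP : P.PosSemidef) (hC : (C * P * Cᵀ).PosDef) :
    (gainOf C P * C) * P * (gainOf C P * C)ᵀ = gainOf C P * C * P := by
  have h := gainOf_mul_mul_one_sub_transpose hP hC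
  rw [Matrix.transpose_sub, Matrix.transpose_one, Matrix.mul_sub, Matrix.mul_one,
    sub_eq_zero] at h
  exact h.symm

lemma posSemidef_sub_gainOf (hP : P.PosSemidef) (hC : (C * P * Cᵀ).PosDef) :
    (P - gainOf C P * C * P).PosSemidef := by
  rw [← one_sub_gainOf_congr hP hC]
  exact posSemidef_congr _ hP

lemma app_one_sub_mul (K : Matrix (Fin n) (Fin q) ℝ) (d : E n) :
    app (1 - K * C) d = d - app K (app C d) := by
  rw [app_sub_matrix, app_one, app_mul]

lemma app_sub_gainOf (hC : (C * P * Cᵀ).PosDef) (d : E n) :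
    app C (d - app (gainOf C P) (app C d)) = 0 := by
  rw [app_sub, ← app_mul C, mul_gainOf hC, app_one, sub_self]

/-- The law of the innovation and the a posteriori error. -/
lemma map_innovation_multivariateGaussian (hP : P.PosSemidef) (hC : (C * P * Cᵀ).PosDef) :
    (multivariateGaussian 0 P).map (fun d => (app C d, d - app (gainOf C P) (app C d))) =
      (multivariateGaussian 0 (C * P * Cᵀ)).prod
        (multivariateGaussian 0 (P - gainOf C P * C * P)) := by
  simp_rw [← app_one_sub_mul]
  rw [map_prodMk_multivariateGaussian _ _ hP (mul_mul_one_sub_gainOf_transpose hP hC),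
    one_sub_gainOf_congr hP hC]

/-- The law of the filtered deviation and the a posteriori error. -/
lemma map_correction_multivariateGaussian (hP : P.PosSemidef) (hC : (C * P * Cᵀ).PosDef) :
    (multivariateGaussian 0 P).map
      (fun d => (app (gainOf C P) (app C d), d - app (gainOf C P) (app C d))) =
      (multivariateGaussian 0 (gainOf C P * C * P)).prod
        (multivariateGaussian 0 (P - gainOf C P * C * P)) := by
  have h := gainOf_mul_mul_one_sub_transpose hP hC
  simp_rw [← app_one_sub_mul, ← app_mul (gainOf C P)]
  rw [map_prodMk_multivariateGaussian _ _ hP h, one_sub_gainOf_congr hP hC,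
    gainOf_mul_congr hP hC]

end Gain

/-! ### Nondegeneracy of the innovation variances. -/

section Riccati

variable {n q : ℕ} {A : Matrix (Fin n) (Fin n) ℝ} {C : Matrix (Fin q) (Fin n) ℝ}
  {S₀ Q : Matrix (Fin n) (Fin n) ℝ}

/-- The two claims need a joint induction: definiteness at time `t` makes the a posteriori variance
semidefinite, and then `C P̂(t+1) Cᵀ` is `C Q Cᵀ` plus a semidefinite term. -/
lemma priorVar_posSemidef_and_posDef (hS₀ : S₀.PosSemidef) (hQ : Q.PosSemidef)
    (hCS₀ : (C * S₀ * Cᵀ).PosDef) (hCQ : (C * Q * Cᵀ).PosDef) (t : ℕ) :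
    (priorVar A C S₀ Q t).PosSemidef ∧ (C * priorVar A C S₀ Q t * Cᵀ).PosDef := by
  induction t with
  | zero => exact ⟨hS₀, hCS₀⟩
  | succ t ih =>
    have h := posSemidef_congr A (posSemidef_sub_gainOf ih.1 ih.2)
    refine ⟨h.add hQ, ?_⟩
    rw [priorVar, Matrix.mul_add, Matrix.add_mul]
    exact Matrix.PosDef.posSemidef_add (posSemidef_congr C h) hCQ

end Riccati

/-! ### Coupling of the two closed loops on each sample path. -/

section Pathwise

variable {n m p q : ℕ} (A : Matrix (Fin n) (Fin n) ℝ) (B : Matrix (Fin n) (Fin m) ℝ)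
  (H : Matrix (Fin p) (Fin n) ℝ) (C : Matrix (Fin q) (Fin n) ℝ)
  (μ₀ : E n) (S₀ Q : Matrix (Fin n) (Fin n) ℝ)

/-- The innovation `v(t+1)` and the error `x(t+1) - x̄(t+1)`, as functions of the error at time `t`
and the noise `w(t)`. -/
noncomputable def errorStep (t : ℕ) (x : E n × E n) : E q × E n :=
  let d := app A x.1 + x.2
  (app C d, d - app (gain A C S₀ Q (t + 1)) (app C d))

/-- The filtered initial state `x̄(0)` and the initial error `x(0) - x̄(0)`. -/
noncomputable def initialSplit (x : E n) : E n × E n :=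
  let y := app (gain A C S₀ Q 0) (app C (x - μ₀))
  (μ₀ + y, x - μ₀ - y)

/-- The initial state and the innovations of the filter, as functions of the initial state and the
noise of the original system. -/
noncomputable def innovations (ω : E n × (ℕ → E n)) : E n × (ℕ → E q) :=
  ((initialSplit A C μ₀ S₀ Q ω.1).1,
    chainOutput (errorStep A C S₀ Q) ((initialSplit A C μ₀ S₀ Q ω.1).2, ω.2))

lemma measurable_errorStep (t : ℕ) : Measurable (errorStep A C S₀ Q t) := by
  have hd : Measurable fun x : E n × E n => app A x.1 + x.2 :=
    ((measurable_app A).comp measurable_fst).add measurable_snd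
  have hC := (measurable_app C).comp hd
  exact hC.prodMk (hd.sub ((measurable_app _).comp hC))

lemma measurable_initialSplit : Measurable (initialSplit A C μ₀ S₀ Q) := by
  have hd : Measurable fun x : E n => x - μ₀ := measurable_id.sub_const _
  have hy := (measurable_app (gain A C S₀ Q 0)).comp ((measurable_app C).comp hd)
  exact (hy.const_add _).prodMk (hd.sub hy)

lemma measurable_innovations : Measurable (innovations A C μ₀ S₀ Q) := by
  have h : Measurable fun ω : E n × (ℕ → E n) => initialSplit A C μ₀ S₀ Q ω.1 :=
    (measurable_initialSplit A C μ₀ S₀ Q).comp measurable_fst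
  exact h.fst.prodMk ((measurable_chainOutput (measurable_errorStep A C S₀ Q)).comp
    (h.snd.prodMk measurable_snd))

lemma History.measurable_last {U : Set (E m)} (t : ℕ) :
    Measurable (History.last : History n U t → E n) := by
  cases t with
  | zero => exact measurable_id
  | succ t => exact measurable_snd.snd

lemma measurable_filterHistory {U : Set (E m)} (t : ℕ) :
    Measurable (filterHistory A B C μ₀ S₀ Q t : History n U t → History n U t) := by
  induction t with
  | zero =>
    exact ((measurable_app _).comp ((measurable_app C).sub_const _)).const_add _
  | succ t ih =>
    have hh : Measurable fun x : History n U t × U × E n =>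
        filterHistory A B C μ₀ S₀ Q t x.1 := ih.comp measurable_fst
    have hl := (History.measurable_last t).comp hh
    have hu : Measurable fun x : History n U t × U × E n => (x.2.1 : E m) :=
      measurable_subtype_coe.comp measurable_snd.fst
    have hx : Measurable fun x : History n U t × U × E n => x.2.2 := measurable_snd.snd
    exact hh.prodMk (measurable_snd.fst.prodMk
      ((((measurable_app A).comp hl).add ((measurable_app B).comp hu)).add
        ((measurable_app _).comp ((((measurable_app C).comp hx).sub
          ((measurable_app (C * A)).comp hl)).sub ((measurable_app (C * B)).comp hu)))))

/-- The refinement of a controller of the abstract system. -/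
noncomputable def Controller.refine {U : Set (E m)} (c' : Controller n U) : Controller n U where
  policy t h := c'.policy t (filterHistory A B C μ₀ S₀ Q t h)
  measurable_policy t :=
    (c'.measurable_policy t).comp (measurable_filterHistory A B C μ₀ S₀ Q t)

lemma GaussianSystem.measurable_execution {r : ℕ} (S : GaussianSystem n m p r) {U : Set (E m)}
    (c : Controller n U) (t : ℕ) : Measurable fun ω => S.execution c ω t := by
  induction t with
  | zero => exact measurable_fst
  | succ t ih =>
    have hu := (c.measurable_policy t).comp ih
    have hw : Measurable fun ω : E n × (ℕ → E r) => ω.2 t :=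
      (measurable_pi_apply t).comp measurable_snd
    exact ih.prodMk (hu.prodMk
      ((((measurable_app S.A).comp ((History.measurable_last t).comp ih)).add
        ((measurable_app S.B).comp (measurable_subtype_coe.comp hu))).add
        ((measurable_app (S.G t)).comp hw)))

lemma GaussianSystem.measurable_output {r : ℕ} (S : GaussianSystem n m p r) {U : Set (E m)}
    (c : Controller n U) : Measurable (S.output c) :=
  measurable_pi_lambda _ fun t => (measurable_app S.H).comp
    ((History.measurable_last t).comp (S.measurable_execution c t))

/-- The filter turns the closed loop of the refined controller into the abstract closed loop driven
by the innovations; the difference of the states is the error process. -/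
lemma filterHistory_execution {U : Set (E m)} (c' : Controller n U) (ω : E n × (ℕ → E n))
    (t : ℕ) :
    filterHistory A B C μ₀ S₀ Q t ((originalSystem A B H μ₀ S₀ Q).execution
        (c'.refine A B C μ₀ S₀ Q) ω t) =
      (abstractSystem A B H C μ₀ S₀ Q).execution c' (innovations A C μ₀ S₀ Q ω) t ∧
    ((originalSystem A B H μ₀ S₀ Q).execution (c'.refine A B C μ₀ S₀ Q) ω t).last =
      ((abstractSystem A B H C μ₀ S₀ Q).execution c' (innovations A C μ₀ S₀ Q ω) t).last +
        chainState (errorStep A C S₀ Q) ((initialSplit A C μ₀ S₀ Q ω.1).2, ω.2) t := by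
  set e := chainState (errorStep A C S₀ Q) ((initialSplit A C μ₀ S₀ Q ω.1).2, ω.2)
  induction t with
  | zero =>
    constructor
    · change μ₀ + app (gain A C S₀ Q 0) (app C ω.1 - app C μ₀) =
        μ₀ + app (gain A C S₀ Q 0) (app C (ω.1 - μ₀))
      rw [app_sub C]
    · change ω.1 = (μ₀ + app (gain A C S₀ Q 0) (app C (ω.1 - μ₀))) +
        (ω.1 - μ₀ - app (gain A C S₀ Q 0) (app C (ω.1 - μ₀)))
      abel
  | succ t ih =>
    obtain ⟨ih₁, ih₂⟩ := ih
    set h := (originalSystem A B H μ₀ S₀ Q).execution (c'.refine A B C μ₀ S₀ Q) ω t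
    set h' := (abstractSystem A B H C μ₀ S₀ Q).execution c' (innovations A C μ₀ S₀ Q ω) t
    set K := gain A C S₀ Q (t + 1)
    -- The refined controller feeds the filtered history to `c'`, so by induction both loops apply
    -- the same input.
    have hu : (c'.refine A B C μ₀ S₀ Q).policy t h = c'.policy t h' := congrArg _ ih₁
    set u := c'.policy t h'
    -- The one-step prediction error `x(t+1) - A x̄(t) - B u(t)`.
    set d := app A (e t) + ω.2 t with hd
    have hx : app A h.last + app B u + app (1 : Matrix (Fin n) (Fin n) ℝ) (ω.2 t) =
        app A h'.last + app B u + d := by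
      rw [ih₂, app_add, app_one, hd]
      abel
    have hexec : (originalSystem A B H μ₀ S₀ Q).execution (c'.refine A B C μ₀ S₀ Q) ω (t + 1) =
        (h, u, app A h'.last + app B u + d) := by
      rw [← hx, ← hu]
      rfl
    have hexec' : (abstractSystem A B H C μ₀ S₀ Q).execution c'
        (innovations A C μ₀ S₀ Q ω) (t + 1) =
        (h', u, app A h'.last + app B u + app K (app C d)) := rfl
    have he' : e (t + 1) = d - app K (app C d) := rfl
    rw [hexec, hexec']
    constructor
    -- Once the filtered history is replaced by `h'`, the computed innovation collapses to `C d`.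
    · change (filterHistory A B C μ₀ S₀ Q t h, u,
        app A (filterHistory A B C μ₀ S₀ Q t h).last + app B u +
          app K (app C (app A h'.last + app B u + d) -
            app (C * A) (filterHistory A B C μ₀ S₀ Q t h).last - app (C * B) u)) = _
      rw [ih₁, app_mul C A, app_mul C B, app_add C,
        app_add C, add_assoc (app C (app A h'.last)),
        add_sub_cancel_left, add_sub_cancel_left]
    · change app A h'.last + app B u + d = app A h'.last + app B u + app K (app C d) + e (t + 1)
      rw [he']
      abel

end Pathwise

/-! ### Equality of outputs and law of the innovations. -/

section Laws

variable {n m p q : ℕ} {A : Matrix (Fin n) (Fin n) ℝ} {B : Matrix (Fin n) (Fin m) ℝ}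
  {H : Matrix (Fin p) (Fin n) ℝ} {C : Matrix (Fin q) (Fin n) ℝ} {N : Matrix (Fin p) (Fin q) ℝ}
  {μ₀ : E n} {S₀ Q : Matrix (Fin n) (Fin n) ℝ}

/-- At every time the error has the form `d - K C d`, which `C` annihilates as `C K = 1`. -/
lemma app_error_eq_zero (hS₀ : S₀.PosSemidef) (hQ : Q.PosSemidef)
    (hCS₀ : (C * S₀ * Cᵀ).PosDef) (hCQ : (C * Q * Cᵀ).PosDef) (x : E n) (w : ℕ → E n) (t : ℕ) :
    app C (chainState (errorStep A C S₀ Q) ((initialSplit A C μ₀ S₀ Q x).2, w) t) = 0 := by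
  have hP := priorVar_posSemidef_and_posDef (A := A) hS₀ hQ hCS₀ hCQ
  cases t with
  | zero => exact app_sub_gainOf (hP 0).2 _
  | succ t => exact app_sub_gainOf (hP (t + 1)).2 _

/-- On every sample path, the closed loops of the refined controller and of the abstract controller
driven by the innovations have the same output. -/
lemma output_refine (hS₀ : S₀.PosSemidef) (hQ : Q.PosSemidef) (hNC : N * C = H)
    (hCS₀ : (C * S₀ * Cᵀ).PosDef) (hCQ : (C * Q * Cᵀ).PosDef) {U : Set (E m)}
    (c' : Controller n U) (ω : E n × (ℕ → E n)) :
    (originalSystem A B H μ₀ S₀ Q).output (c'.refine A B C μ₀ S₀ Q) ω =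
      (abstractSystem A B H C μ₀ S₀ Q).output c' (innovations A C μ₀ S₀ Q ω) := by
  funext t
  change app H _ = app H _
  rw [(filterHistory_execution A B H C μ₀ S₀ Q c' ω t).2, app_add, ← hNC, app_mul, app_mul,
    app_error_eq_zero hS₀ hQ hCS₀ hCQ, app_zero, add_zero]

/-- Prediction gives `d` the variance `P̂(t+1)`; correction then splits it into independent
innovation and error. -/
lemma map_errorStep (hS₀ : S₀.PosSemidef) (hQ : Q.PosSemidef)
    (hCS₀ : (C * S₀ * Cᵀ).PosDef) (hCQ : (C * Q * Cᵀ).PosDef) (t : ℕ) :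
    ((multivariateGaussian 0 (postVar A C S₀ Q t)).prod (multivariateGaussian 0 Q)).map
        (errorStep A C S₀ Q t) =
      (multivariateGaussian 0 (innovationVar A C S₀ Q (t + 1))).prod
        (multivariateGaussian 0 (postVar A C S₀ Q (t + 1))) := by
  have hP := priorVar_posSemidef_and_posDef (A := A) hS₀ hQ hCS₀ hCQ
  have hd : Measurable fun x : E n × E n => app A x.1 + x.2 :=
    ((measurable_app A).comp measurable_fst).add measurable_snd
  have hi : Measurable fun d : E n => (app C d, d - app (gain A C S₀ Q (t + 1)) (app C d)) :=
    (measurable_app C).prodMk (measurable_id.sub ((measurable_app _).comp (measurable_app C)))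
  have hpost : (postVar A C S₀ Q t).PosSemidef := posSemidef_sub_gainOf (hP t).1 (hP t).2
  have hstep : errorStep A C S₀ Q t =
      (fun d : E n => (app C d, d - app (gain A C S₀ Q (t + 1)) (app C d))) ∘
        fun x : E n × E n => app A x.1 + x.2 := rfl
  rw [hstep, ← Measure.map_map hi hd, map_app_add_multivariateGaussian A hpost hQ]
  exact map_innovation_multivariateGaussian (hP (t + 1)).1 (hP (t + 1)).2

/-- The correction at time `0`, without prediction: centre, split, and add the mean back to the
filtered component. -/
lemma map_initialSplit (hS₀ : S₀.PosSemidef) (hCS₀ : (C * S₀ * Cᵀ).PosDef) :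
    (multivariateGaussian μ₀ S₀).map (initialSplit A C μ₀ S₀ Q) =
      (multivariateGaussian μ₀ (S₀ - postVar A C S₀ Q 0)).prod
        (multivariateGaussian 0 (postVar A C S₀ Q 0)) := by
  have hsub : Measurable fun x : E n => -μ₀ + x := by fun_prop
  have hadd : Measurable fun x : E n => μ₀ + x := by fun_prop
  have hy := (measurable_app (gainOf C S₀)).comp (measurable_app C)
  have hi : Measurable fun d : E n =>
      (app (gainOf C S₀) (app C d), d - app (gainOf C S₀) (app C d)) :=
    hy.prodMk (measurable_id.sub hy)
  have hsplit : initialSplit A C μ₀ S₀ Q = Prod.map (fun x => μ₀ + x) id ∘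
      (fun d : E n => (app (gainOf C S₀) (app C d), d - app (gainOf C S₀) (app C d))) ∘
        fun x => -μ₀ + x := by
    funext x
    simp only [Function.comp_apply, neg_add_eq_sub]
    rfl
  have hpost : S₀ - postVar A C S₀ Q 0 = gainOf C S₀ * C * S₀ := sub_sub_cancel _ _
  rw [hsplit, ← Measure.map_map (hadd.prodMap measurable_id) (hi.comp hsub),
    ← Measure.map_map hi hsub, map_const_add_multivariateGaussian, neg_add_cancel,
    map_correction_multivariateGaussian hS₀ hCS₀,
    ← Measure.map_prod_map _ _ hadd measurable_id, map_const_add_multivariateGaussian,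
    Measure.map_id, add_zero, hpost]
  rfl

/-- The filtered initial state and the innovations are distributed as the sources of the abstract
system. -/
lemma map_innovations (hS₀ : S₀.PosSemidef) (hQ : Q.PosSemidef)
    (hCS₀ : (C * S₀ * Cᵀ).PosDef) (hCQ : (C * Q * Cᵀ).PosDef) :
    (originalSystem A B H μ₀ S₀ Q).sourceLaw.map (innovations A C μ₀ S₀ Q) =
      (abstractSystem A B H C μ₀ S₀ Q).sourceLaw := by
  have hs := measurable_initialSplit A C μ₀ S₀ Q
  have hout := measurable_chainOutput (measurable_errorStep A C S₀ Q)
  -- The output of step `t` is `v(t+1)`, whence the variance index `t + 1`, as in `abstractSystem`.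
  have hchain := map_chainOutput_eq_infinitePi (measurable_errorStep A C S₀ Q)
    (fun t => multivariateGaussian 0 (postVar A C S₀ Q t)) (fun _ => multivariateGaussian 0 Q)
    (fun t => multivariateGaussian 0 (innovationVar A C S₀ Q (t + 1)))
    (map_errorStep hS₀ hQ hCS₀ hCQ)
  have hcomp : innovations A C μ₀ S₀ Q = Prod.map id (chainOutput (errorStep A C S₀ Q)) ∘
      MeasurableEquiv.prodAssoc ∘ Prod.map (initialSplit A C μ₀ S₀ Q) id := rfl
  change ((multivariateGaussian μ₀ S₀).prod
      (Measure.infinitePi fun _ => multivariateGaussian 0 Q)).map _ =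
    (multivariateGaussian μ₀ (S₀ - postVar A C S₀ Q 0)).prod
      (Measure.infinitePi fun t => multivariateGaussian 0 (innovationVar A C S₀ Q (t + 1)))
  rw [hcomp, ← Measure.map_map (measurable_id.prodMap hout)
      (MeasurableEquiv.prodAssoc.measurable.comp (hs.prodMap measurable_id)),
    ← Measure.map_map MeasurableEquiv.prodAssoc.measurable (hs.prodMap measurable_id),
    ← Measure.map_prod_map _ _ hs measurable_id, Measure.map_id, map_initialSplit hS₀ hCS₀,
    Measure.prodAssoc_prod, ← Measure.map_prod_map _ _ measurable_id hout, Measure.map_id,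
    hchain]

end Laws

end KnowledgeFiltering

theorem theorem1 {n m p q : ℕ} (hqn : q < n)
    (A : Matrix (Fin n) (Fin n) ℝ) (B : Matrix (Fin n) (Fin m) ℝ) (H : Matrix (Fin p) (Fin n) ℝ)
    (U : Set (EuclideanSpace ℝ (Fin m)))
    (μ₀ : EuclideanSpace ℝ (Fin n)) (S₀ Qw : Matrix (Fin n) (Fin n) ℝ)
    (hS₀ : S₀.PosSemidef) (hQw : Qw.PosSemidef)
    (C : Matrix (Fin q) (Fin n) ℝ) (N : Matrix (Fin p) (Fin q) ℝ) (hNC : N * C = H)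
    (hCS₀ : (C * S₀ * Cᵀ).PosDef) (hCQw : (C * Qw * Cᵀ).PosDef) :
    ∀ c' : Controller n U, ∃ c : Controller n U,
      IsRefinement A B C μ₀ S₀ Qw c' c ∧
      ∀ Zφ : Set (ℕ → EuclideanSpace ℝ (Fin p)), MeasurableSet Zφ →
        (abstractSystem A B H C μ₀ S₀ Qw).outputLaw c' Zφ =
          (originalSystem A B H μ₀ S₀ Qw).outputLaw c Zφ := by
  intro c'
  refine ⟨c'.refine A B C μ₀ S₀ Qw, fun t h => rfl, fun Zφ _ => ?_⟩
  have hout : (originalSystem A B H μ₀ S₀ Qw).output (c'.refine A B C μ₀ S₀ Qw) =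
      (abstractSystem A B H C μ₀ S₀ Qw).output c' ∘ innovations A C μ₀ S₀ Qw :=
    funext (output_refine hS₀ hQw hNC hCS₀ hCQw c')
  rw [GaussianSystem.outputLaw, GaussianSystem.outputLaw, hout,
    ← Measure.map_map (GaussianSystem.measurable_output _ c')
      (measurable_innovations A C μ₀ S₀ Qw), map_innovations hS₀ hQw hCS₀ hCQw]
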